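/- **Conventions.** A poset $\mathbb P$ is a preordered set, where $q\le p$ means that $q$ is stronger than $p$; $\Vdash\varphi$ means that every condition forces $\varphi$. Let $\sqsubset$ be a relation between two spaces $X,Y$ of reals. For $A\subseteq Y$, call $x\in X$ *$\sqsubset$-unbounded over $A$* if $x\not\sqsubset y$ for all $y\in A$. The property $(+_{\mathbb P,\sqsubset})$ says: for every $\mathbb P$-name $\dot y$ of a member of $Y$ there is a countable $A\subseteq Y$ (in the ground model) such that, for every $x\in X$ (in the ground model), if $x$ is $\sqsubset$-unbounded over $A$, then $\Vdash_{\mathbb P} x\not\sqsubset\dot y$. For $f,g\in\omega^\omega$, $f<^*g$ means that there is $n<\omega$ with $f(k)<g(k)$ for all $k\ge n$. An *interval partition* of $\omega$ is a partition $\bar J=\langle J_n\rangle_{n<\omega}$ of $\omega$ into non-empty finite intervals with $\max(J_n)<\min(J_{n+1})$ for all $n$. For an infinite $a\subseteq\omega$ and an interval partition $\bar J$, $a\triangleright\bar J$ means that there is $n<\omega$ such that either $J_k\not\subseteq a$ for all $k\ge n$, or $J_k\not\subseteq\omega\setminus a$ for all $k\ge n$. Random forcing $\mathbb B$ is the set of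 non-zero elements of the Boolean algebra of Borel subsets of $2^\omega$ modulo null sets for the fair-coin measure, ordered by inclusion modulo null sets. Eventually different forcing $\mathbb E$ is the set of pairs $(s,F)$ with $s\in\omega^{<\omega}$ and $F\subseteq\omega^\omega$ finite, ordered by: $(s',F')\le(s,F)$ iff $s\subseteq s'$, $F\subseteq F'$, and $s'(i)\ne f(i)$ for all $f\in F$ and all $i\in\operatorname{dom}(s')\setminus\operatorname{dom}(s)$. **Lemma 2.20.** For every poset $\mathbb P$, $(+_{\mathbb P,<^*})$ implies $(+_{\mathbb P,\triangleright})$. Moreover, $(+_{\mathbb B,\triangleright})$ and $(+_{\mathbb E,\triangleright})$ hold. -/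

import Mathlib

universe u

namespace PresForcing

/-! ## Formulas about one subset of `ω × ω` and the forcing relation -/

/-- Formulas (of arithmetic, with ground-model parameters) about a single unknown set
`R ⊆ ω × ω`. Quantifiers range over the natural numbers; `ground b` is a statement about
ground-model objects only. -/
inductive Fml : Type
  | mem (i j : ℕ) : Fml
  | ground (b : Prop) : Fml
  | neg (φ : Fml) : Fml
  | and (φ ψ : Fml) : Fml
  | all (φ : ℕ → Fml) : Fml

namespace Fml

def or (φ ψ : Fml) : Fml := neg (and (neg φ) (neg ψ))

def imp (φ ψ : Fml) : Fml := neg (and φ (neg ψ))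

def ex (φ : ℕ → Fml) : Fml := neg (all fun n => neg (φ n))

/-- Truth of a formula in the ground model, for an actual set `R ⊆ ω × ω`. -/
def Sat (R : Set (ℕ × ℕ)) : Fml → Prop
  | mem i j => (i, j) ∈ R
  | ground b => b
  | neg φ => ¬ Sat R φ
  | and φ ψ => Sat R φ ∧ Sat R ψ
  | all φ => ∀ n, Sat R (φ n)

@[simp] theorem sat_mem (R : Set (ℕ × ℕ)) (i j : ℕ) : Sat R (mem i j) ↔ (i, j) ∈ R := Iff.rfl

@[simp] theorem sat_ground (R : Set (ℕ × ℕ)) (b : Prop) : Sat R (ground b) ↔ b := Iff.rfl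

@[simp] theorem sat_neg (R : Set (ℕ × ℕ)) (φ : Fml) : Sat R (neg φ) ↔ ¬ Sat R φ := Iff.rfl

@[simp] theorem sat_and (R : Set (ℕ × ℕ)) (φ ψ : Fml) :
    Sat R (and φ ψ) ↔ Sat R φ ∧ Sat R ψ := Iff.rfl

@[simp] theorem sat_all (R : Set (ℕ × ℕ)) (φ : ℕ → Fml) :
    Sat R (all φ) ↔ ∀ n, Sat R (φ n) := Iff.rfl

@[simp] theorem sat_or (R : Set (ℕ × ℕ)) (φ ψ : Fml) :
    Sat R (or φ ψ) ↔ Sat R φ ∨ Sat R ψ := by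
  simp only [or, sat_neg, sat_and]; tauto

@[simp] theorem sat_imp (R : Set (ℕ × ℕ)) (φ ψ : Fml) :
    Sat R (imp φ ψ) ↔ (Sat R φ → Sat R ψ) := by
  simp only [imp, sat_neg, sat_and]; tauto

@[simp] theorem sat_ex (R : Set (ℕ × ℕ)) (φ : ℕ → Fml) :
    Sat R (ex φ) ↔ ∃ n, Sat R (φ n) := by
  simp [ex]

end Fml

/-- `P`-names for subsets of the ground-model set `ω × ω`: the names all of whose elements are
of the form `(x̌, p)` with `x ∈ ω × ω` and `p ∈ P`. In the extension by a generic `G`, such a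
name `τ` is evaluated as `{x | ∃ p ∈ G, (x, p) ∈ τ}`. Every name for a subset of `ω × ω` is
forced to be equal to a name of this form. -/
abbrev Name (P : Type u) : Type u := Set ((ℕ × ℕ) × P)

/-- The forcing relation `p ⊩ φ(τ)`, by the usual recursion on `φ` (a condition `q ≤ p` is
stronger than `p`). -/
def Forces {P : Type u} [Preorder P] (τ : Name P) : P → Fml → Prop
  | p, .mem i j => ∀ q ≤ p, ∃ r ≤ q, ∃ s, ((i, j), s) ∈ τ ∧ r ≤ s
  | _, .ground b => b
  | p, .neg φ => ∀ q ≤ p, ¬ Forces τ q φ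
  | p, .and φ ψ => Forces τ p φ ∧ Forces τ p ψ
  | p, .all φ => ∀ n, Forces τ p (φ n)

/-- `⊩ φ(τ)`: every condition forces `φ(τ)`. -/
def Forced {P : Type u} [Preorder P] (τ : Name P) (φ : Fml) : Prop := ∀ p : P, Forces τ p φ

/-! ## Relations between reals and the preservation property -/

/-- A relation `⊏ = ⋃ₙ ⊏ₙ` between two spaces of reals `X` and `Y`, where the members of `Y` are
coded by subsets of `ω × ω`, together with the formulas that express, in any model, that a set is
a code of a member of `Y` and that `x ⊏ₙ y`. The last three fields say that in the ground model
the codes and the formulas mean what they should. -/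
structure RealRel where
  X : Type
  Y : Type
  relN : ℕ → X → Y → Prop
  code : Y → Set (ℕ × ℕ)
  isCode : Fml
  relFml : ℕ → X → Fml
  code_injective : Function.Injective code
  sat_isCode : ∀ R, Fml.Sat R isCode ↔ R ∈ Set.range code
  sat_relFml : ∀ n x y, Fml.Sat (code y) (relFml n x) ↔ relN n x y

namespace RealRel

/-- `x ⊏ y`. -/
def rel (S : RealRel) (x : S.X) (y : S.Y) : Prop := ∃ n, S.relN n x y

/-- `x` is `⊏`-unbounded over `A`. -/
def UnboundedOver (S : RealRel) (x : S.X) (A : Set S.Y) : Prop := ∀ y ∈ A, ¬ S.rel x y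

/-- `τ` is a `P`-name of a member of `Y`. -/
def IsNameOfReal (S : RealRel) {P : Type u} [Preorder P] (τ : Name P) : Prop :=
  Forced τ S.isCode

/-- The formula `x ⊏ ẏ`. -/
def fml (S : RealRel) (x : S.X) : Fml := Fml.ex fun n => S.relFml n x

end RealRel

/-- The preservation property `(+_{P,⊏})` (for `κ = ℵ₁`): for every `P`-name `ẏ` of a real in
`Y` there is a countable set `A ⊆ Y` of (ground-model) reals such that every `x` which is
`⊏`-unbounded over `A` satisfies `⊩ ¬ (x ⊏ ẏ)`. -/
def Plus (P : Type u) [Preorder P] (S : RealRel) : Prop :=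
  ∀ τ : Name P, S.IsNameOfReal τ →
    ∃ A : Set S.Y, A.Countable ∧
      ∀ x : S.X, S.UnboundedOver x A → Forced τ (Fml.neg (S.fml x))

/-! ## The relation `<*` on `ω^ω` -/

/-- `f <*ₙ g` iff `f k < g k` for all `k ≥ n`; functions are coded by their graphs. -/
def ltStar : RealRel where
  X := ℕ → ℕ
  Y := ℕ → ℕ
  relN n f g := ∀ k ≥ n, f k < g k
  code g := {x | x.2 = g x.1}
  isCode := Fml.and
    (Fml.all fun k => Fml.ex fun m => Fml.mem k m)
    (Fml.all fun k => Fml.all fun m => Fml.all fun m' =>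
      Fml.imp (Fml.and (Fml.mem k m) (Fml.mem k m')) (Fml.ground (m = m')))
  relFml n f := Fml.all fun k => Fml.imp (Fml.ground (k ≥ n))
    (Fml.ex fun m => Fml.and (Fml.mem k m) (Fml.ground (f k < m)))
  code_injective := by
    intro g g' h
    funext k
    exact (Set.ext_iff.1 h (k, g k)).1 rfl
  sat_isCode := by
    intro R
    simp only [Fml.sat_and, Fml.sat_all, Fml.sat_ex, Fml.sat_mem, Fml.sat_imp, Fml.sat_ground,
      Set.mem_range]
    constructor
    · rintro ⟨h1, h2⟩
      choose g hg using h1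
      refine ⟨g, ?_⟩
      ext ⟨k, m⟩
      constructor
      · intro h
        have h' : m = g k := h
        rw [h']; exact hg k
      · intro h
        exact h2 k m (g k) ⟨h, hg k⟩
    · rintro ⟨g, rfl⟩
      simp
  sat_relFml := by
    intro n f g
    simp

/-! ## The finitely splitting relation `▷` -/

/-- `⟨J n⟩` is an interval partition of `ω`: a partition of `ω` into non-empty finite intervals
such that `max (J n) < min (J (n + 1))` for all `n`. -/
structure IsIntervalPartition (J : ℕ → Set ℕ) : Prop where
  nonempty : ∀ n, (J n).Nonempty
  finite : ∀ n, (J n).Finite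
  interval : ∀ n, (J n).OrdConnected
  disjoint : ∀ m n, m ≠ n → Disjoint (J m) (J n)
  cover : ⋃ n, J n = Set.univ
  lt_next : ∀ n, ∀ i ∈ J n, ∀ j ∈ J (n + 1), i < j

/-- The formula saying that the sets `{i | (n, i) ∈ R}` form an interval partition. -/
def intervalPartitionFml : Fml :=
  Fml.and (Fml.all fun n => Fml.ex fun i => Fml.mem n i) <|
  Fml.and (Fml.all fun n => Fml.ex fun b => Fml.all fun i =>
    Fml.imp (Fml.mem n i) (Fml.ground (i ≤ b))) <|
  Fml.and (Fml.all fun n => Fml.all fun i => Fml.all fun j => Fml.all fun k =>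
    Fml.imp (Fml.and (Fml.and (Fml.mem n i) (Fml.mem n k)) (Fml.ground (i ≤ j ∧ j ≤ k)))
      (Fml.mem n j)) <|
  Fml.and (Fml.all fun m => Fml.all fun n => Fml.imp (Fml.ground (m ≠ n)) <|
    Fml.all fun i => Fml.neg (Fml.and (Fml.mem m i) (Fml.mem n i))) <|
  Fml.and (Fml.all fun i => Fml.ex fun n => Fml.mem n i)
    (Fml.all fun n => Fml.all fun i => Fml.all fun j =>
      Fml.imp (Fml.and (Fml.mem n i) (Fml.mem (n + 1) j)) (Fml.ground (i < j)))

theorem sat_intervalPartitionFml (R : Set (ℕ × ℕ)) :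
    Fml.Sat R intervalPartitionFml ↔ IsIntervalPartition fun n => {i | (n, i) ∈ R} := by
  simp only [intervalPartitionFml, Fml.sat_and, Fml.sat_all, Fml.sat_ex, Fml.sat_mem,
    Fml.sat_imp, Fml.sat_ground, Fml.sat_neg]
  constructor
  · rintro ⟨h1, h2, h3, h4, h5, h6⟩
    refine ⟨h1, fun n => ?_, fun n => ⟨?_⟩, fun m n hmn => ?_, ?_, fun n i hi j hj =>
      h6 n i j ⟨hi, hj⟩⟩
    · obtain ⟨b, hb⟩ := h2 n
      exact (Set.finite_Iic b).subset hb
    · intro i hi k hk j hj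
      exact h3 n i j k ⟨⟨hi, hk⟩, hj.1, hj.2⟩
    · exact Set.disjoint_left.2 fun i hi hi' => h4 m n hmn i ⟨hi, hi'⟩
    · exact Set.eq_univ_of_forall fun i => Set.mem_iUnion.2 (h5 i)
  · rintro ⟨h1, h2, h3, h4, h5, h6⟩
    refine ⟨h1, fun n => ?_, ?_, ?_, fun i => ?_, fun n i j h => h6 n i h.1 j h.2⟩
    · obtain ⟨b, hb⟩ := (h2 n).bddAbove
      exact ⟨b, fun i hi => hb hi⟩
    · rintro n i j k ⟨⟨hi, hk⟩, hj⟩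
      exact (h3 n).out hi hk ⟨hj.1, hj.2⟩
    · rintro m n hmn i ⟨hi, hi'⟩
      exact Set.disjoint_left.1 (h4 m n hmn) hi hi'
    · have : i ∈ ⋃ n, {i | (n, i) ∈ R} := by rw [h5]; trivial
      exact Set.mem_iUnion.1 this

/-- The formula `J_k ⊆ b`. -/
def blockSubsetFml (k : ℕ) (b : Set ℕ) : Fml :=
  Fml.all fun i => Fml.imp (Fml.mem k i) (Fml.ground (i ∈ b))

/-- For `a ∈ [ω]^ω` and an interval partition `J`, `a ▷ₙ J` iff `J k ⊈ a` for all `k ≥ n`, or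
`J k ⊈ ω \ a` for all `k ≥ n`. An interval partition `J` is coded by `{(n, i) | i ∈ J n}`. -/
def finSplit : RealRel where
  X := {a : Set ℕ // a.Infinite}
  Y := {J : ℕ → Set ℕ // IsIntervalPartition J}
  relN n a J := (∀ k ≥ n, ¬ J.1 k ⊆ a.1) ∨ (∀ k ≥ n, ¬ J.1 k ⊆ (a.1)ᶜ)
  code J := {x | x.2 ∈ J.1 x.1}
  isCode := intervalPartitionFml
  relFml n a := Fml.or
    (Fml.all fun k => Fml.imp (Fml.ground (k ≥ n)) (Fml.neg (blockSubsetFml k a.1)))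
    (Fml.all fun k => Fml.imp (Fml.ground (k ≥ n)) (Fml.neg (blockSubsetFml k (a.1)ᶜ)))
  code_injective := by
    intro J J' h
    apply Subtype.ext
    funext n
    ext i
    exact Set.ext_iff.1 h (n, i)
  sat_isCode := by
    intro R
    rw [sat_intervalPartitionFml]
    constructor
    · intro h
      exact ⟨⟨_, h⟩, rfl⟩
    · rintro ⟨J, rfl⟩
      exact J.2
  sat_relFml := by
    intro n a J
    simp only [blockSubsetFml, Fml.sat_or, Fml.sat_all, Fml.sat_imp, Fml.sat_ground, Fml.sat_neg,
      Fml.sat_mem]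
    rfl

/-! ## Random forcing -/

/-- The fair-coin measure on the Cantor space `2^ω`. -/
noncomputable def cantorMeasure : MeasureTheory.Measure (ℕ → Bool) :=
  MeasureTheory.Measure.infinitePi fun _ : ℕ => (PMF.uniformOfFintype Bool).toMeasure

/-- The Borel subsets of `2^ω` which are not null, -/
def PosBorel : Type := {A : Set (ℕ → Bool) // MeasurableSet A ∧ cantorMeasure A ≠ 0}

/-- ordered by inclusion modulo null sets. -/
instance : Preorder PosBorel where
  le A B := cantorMeasure (A.1 \ B.1) = 0
  le_refl A := by simp
  le_trans A B C h1 h2 := by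
    refine MeasureTheory.measure_mono_null ?_ (MeasureTheory.measure_union_null h1 h2)
    intro x hx
    by_cases h : x ∈ B.1
    · exact Or.inr ⟨h, hx.2⟩
    · exact Or.inl ⟨hx.1, h⟩

/-- Random forcing `𝔹`: the non-zero elements of the Boolean algebra of Borel subsets of `2^ω`
modulo null sets, i.e. the classes of non-null Borel sets under equality modulo null sets,
ordered by inclusion modulo null sets. -/
abbrev RandomForcing : Type := Antisymmetrization PosBorel (· ≤ ·)

/-! ## Eventually different forcing -/

/-- Eventually different real forcing `𝔼`: conditions `(s, F)` with `s` a finite sequence of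
natural numbers and `F` a finite set of functions from `ω` to `ω`. -/
@[ext] structure EvDiffForcing : Type where
  stem : List ℕ
  side : Finset (ℕ → ℕ)

/-- `(s', F') ≤ (s, F)` iff `s'` extends `s`, `F ⊆ F'` and `s'(i) ≠ f(i)` for all `f ∈ F` and
`i ∈ dom s' \ dom s`. -/
instance : PartialOrder EvDiffForcing where
  le p q := q.stem <+: p.stem ∧ q.side ⊆ p.side ∧
    ∀ (i : ℕ) (hi : i < p.stem.length), q.stem.length ≤ i → ∀ f ∈ q.side, p.stem[i] ≠ f i
  le_refl p := ⟨List.prefix_refl _, Finset.Subset.refl _, fun i hi hi' => by omega⟩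
  le_trans p q r h1 h2 := by
    refine ⟨h2.1.trans h1.1, h2.2.1.trans h1.2.1, fun i hi hi' f hf => ?_⟩
    by_cases h : i < q.stem.length
    · have := h2.2.2 i h hi' f hf
      rwa [h1.1.getElem h] at this
    · exact h1.2.2 i hi (by omega) f (h2.2.1 hf)
  le_antisymm p q h1 h2 :=
    EvDiffForcing.ext (h2.1.eq_of_length_le h1.1.length_le) (Finset.Subset.antisymm h2.2.1 h1.2.1)

end PresForcing

namespace PresForcing

open Filter Set MeasureTheory

/-! ## The forcing relation and sufficiently generic filters -/

section Generic

variable {P : Type u} [Preorder P]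

/-! Forcing statements are turned into statements about actual reals: a formula is forced iff it
holds of `eval τ G` for all filters `G` meeting suitable countably many dense sets
(`forced_iff_eventually`).

From `<*` to `▷`: a set `c` is replaced by the function `nextOutside c`, which sends `i` to the end
of the run of `c` starting at `i`, and a partition `J` by `blockEnd J`. If `nextOutside c` is not
`<*`-below `blockEnd J`, then infinitely many runs of `c` contain a block of `J`
(`exists_block_subset`). Conversely, a countable `A` is dominated by one function `h`, and blocks
long enough to jump past `h` give one partition such that any co-infinite `c` containing infinitely
many of its blocks has `nextOutside c` unbounded over `A`. Both facts are applied to `a` and to its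
complement.

For `𝔹` and `𝔼`: a poset that is a countable union of `Bounding` pieces satisfies the property for
`<*`. The pieces are the sets of measure at least `1/n` for `𝔹`, and the conditions with fixed stem
and fixed number of side functions for `𝔼`. -/

theorem Forces.mono {τ : Name P} {φ : Fml} {p q : P} (h : Forces τ p φ) (hqp : q ≤ p) :
    Forces τ q φ := by
  induction φ with
  | mem i j => exact fun r hr => h r (hr.trans hqp)
  | ground b => exact h
  | neg φ _ => exact fun r hr => h r (hr.trans hqp)
  | and φ ψ ihφ ihψ => exact ⟨ihφ h.1, ihψ h.2⟩
  | all φ ih => exact fun n => ih n (h n)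

/-- The clause for `mem` is already a density statement, and density passes through the other
clauses by induction; hence the conditions deciding a formula are dense. -/
theorem exists_forces_neg {τ : Name P} {φ : Fml} {p : P} (h : ¬ Forces τ p φ) :
    ∃ q ≤ p, Forces τ q (.neg φ) := by
  induction φ generalizing p with
  | mem i j =>
    simp only [Forces, not_forall] at h
    obtain ⟨q, hq, hn⟩ := h
    refine ⟨q, hq, fun r hr hf => hn ?_⟩
    obtain ⟨t, ht, s, hs⟩ := hf r le_rfl
    exact ⟨t, ht.trans hr, s, hs⟩
  | ground b => exact ⟨p, le_rfl, fun _ _ hb => h hb⟩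
  | neg φ _ =>
    simp only [Forces, not_forall, not_not] at h
    obtain ⟨q, hq, hf⟩ := h
    exact ⟨q, hq, fun r hr hn => hn r le_rfl (hf.mono hr)⟩
  | and φ ψ ihφ ihψ =>
    by_cases hφ : Forces τ p φ
    · obtain ⟨q, hq, hf⟩ := ihψ fun hψ => h ⟨hφ, hψ⟩
      exact ⟨q, hq, fun r hr hn => hf r hr hn.2⟩
    · obtain ⟨q, hq, hf⟩ := ihφ hφ
      exact ⟨q, hq, fun r hr hn => hf r hr hn.1⟩
  | all φ ih =>
    obtain ⟨n, hn⟩ := not_forall.1 h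
    obtain ⟨q, hq, hf⟩ := ih n hn
    exact ⟨q, hq, fun r hr hn => hf r hr (hn n)⟩

/-- A property holds for `generic P` if it holds for all filters on `P` that meet every member of
some countable family of dense sets. -/
def generic (P : Type u) [Preorder P] : Filter (Order.PFilter P) :=
  countableGenerate {S | ∃ D : Set P, (∀ p, ∃ q ≤ p, q ∈ D) ∧ S = {G | ∃ p ∈ G, p ∈ D}}

instance : CountableInterFilter (generic P) := by
  unfold generic; infer_instance

theorem eventually_generic_of_dense {D : Set P} (hD : ∀ p, ∃ q ≤ p, q ∈ D) :
    ∀ᶠ G in generic P, ∃ p ∈ G, p ∈ D :=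
  mem_countableGenerate_iff.2 ⟨_, singleton_subset_iff.2 ⟨D, hD, rfl⟩, countable_singleton _,
    (sInter_singleton _).subset⟩

/-- The Rasiowa–Sikorski lemma. -/
theorem exists_mem_of_eventually_generic {Q : Order.PFilter P → Prop} (h : ∀ᶠ G in generic P, Q G)
    (p : P) : ∃ G : Order.PFilter P, p ∈ G ∧ Q G := by
  obtain ⟨S, hS, hc, hsub⟩ := mem_countableGenerate_iff.1 h
  have := hc.toEncodable
  choose D hD hSD using fun s : S => hS s.2
  let 𝒟 : S → Order.Cofinal Pᵒᵈ := fun s => ⟨{q | OrderDual.ofDual q ∈ D s}, fun q => by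
    obtain ⟨r, hr, hrD⟩ := hD s (OrderDual.ofDual q)
    exact ⟨OrderDual.toDual r, hrD, hr⟩⟩
  refine ⟨⟨Order.idealOfCofinals (OrderDual.toDual p) 𝒟⟩,
    Order.mem_idealOfCofinals (OrderDual.toDual p) 𝒟, hsub fun s hs => ?_⟩
  obtain ⟨q, hq, hqG⟩ := Order.cofinal_meets_idealOfCofinals (OrderDual.toDual p) 𝒟 ⟨s, hs⟩
  exact (hSD ⟨s, hs⟩).superset ⟨OrderDual.ofDual q, hqG, hq⟩

theorem exists_le_le_of_mem {G : Order.PFilter P} {p q : P} (hp : p ∈ G) (hq : q ∈ G) :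
    ∃ r ∈ G, r ≤ p ∧ r ≤ q := by
  obtain ⟨r, hr, h1, h2⟩ := G.directed p hp q hq
  exact ⟨r, hr, h1, h2⟩

/-- The evaluation of a name by a filter. -/
def eval (τ : Name P) (G : Order.PFilter P) : Set (ℕ × ℕ) := {x | ∃ p ∈ G, (x, p) ∈ τ}

/-- The truth lemma: only countably many dense sets are needed, since a formula has countably many
subformulas. -/
theorem eventually_sat_iff (τ : Name P) (φ : Fml) :
    ∀ᶠ G in generic P, Fml.Sat (eval τ G) φ ↔ ∃ p ∈ G, Forces τ p φ := by
  induction φ with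
  | mem i j =>
    have hD : ∀ p : P, ∃ q ≤ p,
        q ∈ {r | Forces τ r (.neg (.mem i j)) ∨ ∃ s, ((i, j), s) ∈ τ ∧ r ≤ s} := fun p => by
      by_cases h : Forces τ p (.mem i j)
      · obtain ⟨r, hr, s, hs⟩ := h p le_rfl
        exact ⟨r, hr, .inr ⟨s, hs⟩⟩
      · obtain ⟨q, hq, hf⟩ := exists_forces_neg h
        exact ⟨q, hq, .inl hf⟩
    filter_upwards [eventually_generic_of_dense hD] with G hG
    constructor
    · rintro ⟨s, hsG, hs⟩
      refine ⟨s, hsG, fun q hq => ⟨q, le_rfl, s, hs, hq⟩⟩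
    · rintro ⟨p, hp, hf⟩
      obtain ⟨q, hq, hn | ⟨s, hs, hqs⟩⟩ := hG
      · obtain ⟨r, -, hrp, hrq⟩ := exists_le_le_of_mem hp hq
        exact (hn r hrq (hf.mono hrp)).elim
      · exact ⟨s, Order.PFilter.mem_of_le hqs hq, hs⟩
  | ground b =>
    refine .of_forall fun G => ⟨fun hb => ?_, fun ⟨p, _, hb⟩ => hb⟩
    obtain ⟨p, hp⟩ := G.nonempty
    exact ⟨p, hp, hb⟩
  | neg φ ih =>
    have hD : ∀ p : P, ∃ q ≤ p, q ∈ {r | Forces τ r φ ∨ Forces τ r (.neg φ)} := fun p => by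
      by_cases h : Forces τ p φ
      · exact ⟨p, le_rfl, .inl h⟩
      · obtain ⟨q, hq, hf⟩ := exists_forces_neg h
        exact ⟨q, hq, .inr hf⟩
    filter_upwards [ih, eventually_generic_of_dense hD] with G hφ hG
    rw [Fml.sat_neg, hφ]
    constructor
    · intro h
      obtain ⟨p, hp, hf | hf⟩ := hG
      · exact (h ⟨p, hp, hf⟩).elim
      · exact ⟨p, hp, hf⟩
    · rintro ⟨p, hp, hn⟩ ⟨q, hq, hf⟩
      obtain ⟨r, -, hrp, hrq⟩ := exists_le_le_of_mem hp hq
      exact hn r hrp (hf.mono hrq)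
  | and φ ψ ihφ ihψ =>
    filter_upwards [ihφ, ihψ] with G hφ hψ
    rw [Fml.sat_and, hφ, hψ]
    constructor
    · rintro ⟨⟨p, hp, hf⟩, q, hq, hg⟩
      obtain ⟨r, hr, hrp, hrq⟩ := exists_le_le_of_mem hp hq
      exact ⟨r, hr, hf.mono hrp, hg.mono hrq⟩
    · rintro ⟨p, hp, hf⟩
      exact ⟨⟨p, hp, hf.1⟩, p, hp, hf.2⟩
  | all φ ih =>
    have hD : ∀ p : P, ∃ q ≤ p, q ∈ {r | Forces τ r (.all φ) ∨ ∃ n, Forces τ r (.neg (φ n))} :=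
      fun p => by
        by_cases h : Forces τ p (.all φ)
        · exact ⟨p, le_rfl, .inl h⟩
        · obtain ⟨n, hn⟩ := not_forall.1 h
          obtain ⟨q, hq, hf⟩ := exists_forces_neg hn
          exact ⟨q, hq, .inr ⟨n, hf⟩⟩
    filter_upwards [eventually_countable_forall.2 ih, eventually_generic_of_dense hD] with G hφ hG
    rw [Fml.sat_all]
    constructor
    · intro h
      obtain ⟨p, hp, hf | ⟨n, hn⟩⟩ := hG
      · exact ⟨p, hp, hf⟩
      · obtain ⟨q, hq, hf⟩ := (hφ n).1 (h n)
        obtain ⟨r, -, hrp, hrq⟩ := exists_le_le_of_mem hp hq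
        exact (hn r hrp (hf.mono hrq)).elim
    · rintro ⟨p, hp, hf⟩ n
      exact (hφ n).2 ⟨p, hp, hf n⟩

theorem forced_iff_eventually {τ : Name P} {φ : Fml} :
    Forced τ φ ↔ ∀ᶠ G in generic P, Fml.Sat (eval τ G) φ := by
  constructor
  · intro h
    filter_upwards [eventually_sat_iff τ φ] with G hG
    obtain ⟨p, hp⟩ := G.nonempty
    exact hG.2 ⟨p, hp, h p⟩
  · intro h p
    by_contra hp
    obtain ⟨q, -, hn⟩ := exists_forces_neg hp
    obtain ⟨G, hqG, hφ, hneg⟩ :=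
      exists_mem_of_eventually_generic (h.and (eventually_sat_iff τ (.neg φ))) q
    exact hneg.2 ⟨q, hqG, hn⟩ hφ

/-- The name for the set `{(i, j) | ψ i j}` defined in the extension from `τ`. -/
def definedName (τ : Name P) (ψ : ℕ → ℕ → Fml) : Name P :=
  {x | Forces τ x.2 (ψ x.1.1 x.1.2)}

theorem eventually_eval_definedName (τ : Name P) (ψ : ℕ → ℕ → Fml) :
    ∀ᶠ G in generic P,
      eval (definedName τ ψ) G = {x | Fml.Sat (eval τ G) (ψ x.1 x.2)} := by
  filter_upwards [eventually_countable_forall.2 fun x : ℕ × ℕ =>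
    eventually_sat_iff τ (ψ x.1 x.2)] with G hG
  ext x
  exact (hG x).symm

end Generic

theorem RealRel.sat_neg_fml (S : RealRel) (x : S.X) (y : S.Y) :
    Fml.Sat (S.code y) (.neg (S.fml x)) ↔ ¬ S.rel x y := by
  simp only [RealRel.fml, RealRel.rel, Fml.sat_neg, Fml.sat_ex, S.sat_relFml]

/-! ## From `<*` to `▷` -/

theorem exists_unboundedOver_of_countable {A : Set (ℕ → ℕ)} (hA : A.Countable) :
    ∃ h : ℕ → ℕ, ∀ x : ℕ → ℕ, (∀ n, ∃ k ≥ n, h k ≤ x k) → ltStar.UnboundedOver x A := by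
  obtain ⟨e, he⟩ := countable_iff_exists_subset_range.1 hA
  refine ⟨fun k => (Finset.range (k + 1)).sup fun i => e i k, fun x hx y hy => ?_⟩
  obtain ⟨i, rfl⟩ := he hy
  rintro ⟨n, hn⟩
  -- Beyond `i`, the maximum defining `h` includes the value of `e i`.
  obtain ⟨k, hk, hxk⟩ := hx (max n i)
  have h1 : x k < e i k := hn k ((le_max_left _ _).trans hk)
  have h2 : e i k ≤ (Finset.range (k + 1)).sup fun i => e i k :=
    Finset.le_sup (f := fun i => e i k)
      (Finset.mem_range.2 (Nat.lt_succ_of_le ((le_max_right _ _).trans hk)))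
  exact absurd (h2.trans hxk) (not_le.2 h1)

theorem isIntervalPartition_Ico {b : ℕ → ℕ} (hb : StrictMono b) (h0 : b 0 = 0) :
    IsIntervalPartition fun n => Ico (b n) (b (n + 1)) where
  nonempty n := ⟨b n, le_rfl, hb n.lt_succ_self⟩
  finite n := finite_Ico _ _
  interval n := ordConnected_Ico
  disjoint m n hmn := by
    refine disjoint_left.2 fun i hi hi' => hmn ?_
    have h1 := hb.lt_iff_lt.1 (hi.1.trans_lt hi'.2)
    have h2 := hb.lt_iff_lt.1 (hi'.1.trans_lt hi.2)
    omega
  cover := by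
    refine eq_univ_of_forall fun i => mem_iUnion.2 ?_
    induction i with
    | zero => exact ⟨0, h0.le, (Nat.zero_le _).trans_lt (hb Nat.zero_lt_one)⟩
    | succ i ih =>
      obtain ⟨n, hn⟩ := ih
      by_cases h : i + 1 < b (n + 1)
      · exact ⟨n, hn.1.trans i.le_succ, h⟩
      · exact ⟨n + 1, not_lt.1 h, (Nat.succ_le_of_lt hn.2).trans_lt (hb (n + 1).lt_succ_self)⟩
  lt_next n i hi j hj := hi.2.trans_le hj.1

theorem IsIntervalPartition.lt_of_lt {J : ℕ → Set ℕ} (hJ : IsIntervalPartition J) {m n : ℕ}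
    (hmn : m < n) {i j : ℕ} (hi : i ∈ J m) (hj : j ∈ J n) : i < j := by
  induction n, hmn using Nat.le_induction generalizing j with
  | base => exact hJ.lt_next m i hi j hj
  | succ n _ ih =>
    obtain ⟨l, hl⟩ := hJ.nonempty n
    exact (ih hl).trans (hJ.lt_next n l hl j hj)

theorem IsIntervalPartition.exists_subset_Ico {J : ℕ → Set ℕ} (hJ : IsIntervalPartition J)
    (i : ℕ) : ∃ j k, J k ⊆ Ico i j := by
  obtain ⟨k, hk⟩ : ∃ k, i ∈ J k := mem_iUnion.1 (hJ.cover ▸ mem_univ i)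
  obtain ⟨b, hb⟩ := (hJ.finite (k + 1)).bddAbove
  exact ⟨b + 1, k + 1, fun l hl => ⟨(hJ.lt_next k i hk l hl).le, Nat.lt_succ_of_le (hb hl)⟩⟩

/-- The least `m ≥ n` outside `c`. -/
noncomputable def nextOutside (c : Set ℕ) (n : ℕ) : ℕ := sInf {m | n ≤ m ∧ m ∉ c}

theorem Ico_nextOutside_subset (c : Set ℕ) (n : ℕ) : Ico n (nextOutside c n) ⊆ c := by
  intro i hi
  by_contra h
  exact not_le.2 hi.2 (Nat.sInf_le ⟨hi.1, h⟩)

/-- Co-infinity of `c` excludes the junk value `sInf ∅ = 0`. -/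
theorem le_nextOutside {c : Set ℕ} (hc : ∀ n, ∃ m ≥ n, m ∉ c) {n j : ℕ} (h : Ico n j ⊆ c) :
    j ≤ nextOutside c n := by
  have hs : nextOutside c n ∈ {m | n ≤ m ∧ m ∉ c} := Nat.sInf_mem (hc n)
  by_contra hj
  exact hs.2 (h ⟨hs.1, not_le.1 hj⟩)

/-- The formula `∃ k, J_k ⊆ [i, j)`. -/
def blockBetweenFml (i j : ℕ) : Fml := Fml.ex fun k => blockSubsetFml k (Ico i j)

/-- The formula saying that `j` is least such that `[i, j)` contains a block. -/
def leastBlockFml (i j : ℕ) : Fml :=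
  Fml.and (blockBetweenFml i j)
    (Fml.all fun j' => Fml.imp (blockBetweenFml i j') (Fml.ground (j ≤ j')))

theorem sat_blockBetweenFml (J : finSplit.Y) (i j : ℕ) :
    Fml.Sat (finSplit.code J) (blockBetweenFml i j) ↔ ∃ k, J.1 k ⊆ Ico i j := by
  simp only [blockBetweenFml, blockSubsetFml, Fml.sat_ex, Fml.sat_all, Fml.sat_imp, Fml.sat_mem,
    Fml.sat_ground]
  rfl

/-- The least `j` such that `[i, j)` contains a block of `J`. -/
noncomputable def blockEnd (J : ℕ → Set ℕ) (i : ℕ) : ℕ := sInf {j | ∃ k, J k ⊆ Ico i j}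

theorem IsIntervalPartition.exists_subset_Ico_blockEnd {J : ℕ → Set ℕ}
    (hJ : IsIntervalPartition J) (i : ℕ) : ∃ k, J k ⊆ Ico i (blockEnd J i) :=
  Nat.sInf_mem (s := {j | ∃ k, J k ⊆ Ico i j}) (hJ.exists_subset_Ico i)

/-- `blockEnd` is arithmetically definable from the partition, so a name for the partition yields a
name for the function. -/
theorem setOf_sat_leastBlockFml (J : finSplit.Y) :
    {x : ℕ × ℕ | Fml.Sat (finSplit.code J) (leastBlockFml x.1 x.2)} =
      ltStar.code (blockEnd J.1) := by
  ext ⟨i, j⟩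
  simp only [leastBlockFml, mem_ofPred_eq, Fml.sat_and, Fml.sat_all, Fml.sat_imp,
    sat_blockBetweenFml, Fml.sat_ground]
  change _ ↔ j = blockEnd J.1 i
  constructor
  · rintro ⟨h1, h2⟩
    exact le_antisymm (h2 _ (J.2.exists_subset_Ico_blockEnd i)) (Nat.sInf_le h1)
  · rintro rfl
    exact ⟨J.2.exists_subset_Ico_blockEnd i, fun j' hj' => Nat.sInf_le hj'⟩

theorem IsIntervalPartition.exists_block_subset {J : ℕ → Set ℕ} (hJ : IsIntervalPartition J)
    {c : Set ℕ} (h : ¬ ltStar.rel (nextOutside c) (blockEnd J)) (n : ℕ) : ∃ k ≥ n, J k ⊆ c := by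
  obtain ⟨i₀, hi₀⟩ := hJ.nonempty n
  obtain ⟨i, hi, hle⟩ : ∃ i ≥ i₀, blockEnd J i ≤ nextOutside c i := by
    by_contra! hlt
    exact h ⟨i₀, hlt⟩
  obtain ⟨k, hk⟩ := hJ.exists_subset_Ico_blockEnd i
  refine ⟨k, ?_, fun l hl => Ico_nextOutside_subset c i ⟨(hk hl).1, (hk hl).2.trans_le hle⟩⟩
  -- A block with index below `n` would lie entirely to the left of `i₀ ∈ J n`, but block `k` starts
  -- at or after `i ≥ i₀`.
  by_contra hkn
  obtain ⟨l, hl⟩ := hJ.nonempty k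
  exact absurd (hi.trans (hk hl).1) (not_le.2 (hJ.lt_of_lt (not_le.1 hkn) hl hi₀))

theorem not_finSplit_rel_iff (a : finSplit.X) (J : finSplit.Y) :
    ¬ finSplit.rel a J ↔
      (∀ n, ∃ k ≥ n, J.1 k ⊆ a.1) ∧ ∀ n, ∃ k ≥ n, J.1 k ⊆ (a.1)ᶜ := by
  change (¬ ∃ n, (∀ k ≥ n, ¬ J.1 k ⊆ a.1) ∨ ∀ k ≥ n, ¬ J.1 k ⊆ (a.1)ᶜ) ↔ _
  push Not
  exact forall_and

/-- Every countable set of functions admits a single interval partition such that a set `c`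
containing infinitely many blocks, with infinite complement, has `nextOutside c` unbounded. -/
theorem exists_partition_unboundedOver {A : Set (ℕ → ℕ)} (hA : A.Countable) :
    ∃ J : finSplit.Y, ∀ c : Set ℕ, (∀ n, ∃ m ≥ n, m ∉ c) → (∀ n, ∃ k ≥ n, J.1 k ⊆ c) →
      ltStar.UnboundedOver (nextOutside c) A := by
  obtain ⟨h, hh⟩ := exists_unboundedOver_of_countable hA
  -- Each endpoint exceeds `h` of the previous one, so a set containing the block from `b k` has
  -- `nextOutside` above `h` at `b k`.
  let b : ℕ → ℕ := fun n => Nat.rec 0 (fun _ m => max m (h m) + 1) n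
  have hbs : ∀ n, b (n + 1) = max (b n) (h (b n)) + 1 := fun n => rfl
  have hb : StrictMono b := strictMono_nat_of_lt_succ fun n => by
    rw [hbs]; exact Nat.lt_succ_of_le (le_max_left _ _)
  refine ⟨⟨_, isIntervalPartition_Ico hb rfl⟩, fun c hc hJ => hh _ fun n => ?_⟩
  obtain ⟨k, hk, hkc⟩ := hJ n
  refine ⟨b k, hk.trans (hb.id_le k), le_trans ?_ (le_nextOutside hc hkc)⟩
  rw [hbs]
  exact (le_max_right _ _).trans (Nat.le_succ _)

theorem Plus.finSplit_of_ltStar {P : Type u} [Preorder P] (hP : Plus P ltStar) :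
    Plus P finSplit := by
  intro τ hτ
  have hJ : ∀ᶠ G in generic P, ∃ J : PresForcing.finSplit.Y,
      eval τ G = PresForcing.finSplit.code J ∧
        eval (definedName τ leastBlockFml) G = ltStar.code (blockEnd J.1) := by
    filter_upwards [forced_iff_eventually.1 hτ, eventually_eval_definedName τ leastBlockFml]
      with G hG hσ
    obtain ⟨J, hJ⟩ := (PresForcing.finSplit.sat_isCode _).1 hG
    exact ⟨J, hJ.symm, by rw [hσ, ← hJ, setOf_sat_leastBlockFml]⟩
  obtain ⟨A, hA, hAx⟩ := hP (definedName τ leastBlockFml) <| forced_iff_eventually.2 <| by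
    filter_upwards [hJ] with G ⟨J, _, hG⟩
    exact (ltStar.sat_isCode _).2 ⟨_, hG.symm⟩
  obtain ⟨J₀, hJ₀⟩ := exists_partition_unboundedOver hA
  refine ⟨{J₀}, countable_singleton _, fun a ha => forced_iff_eventually.2 ?_⟩
  obtain ⟨h1, h2⟩ := (not_finSplit_rel_iff a J₀).1 (ha J₀ rfl)
  -- Applied to the complement of `a` and to `a`, this supplies the co-infinity of `a` and of its
  -- complement.
  have escape : ∀ c : Set ℕ, (∀ n, ∃ k ≥ n, J₀.1 k ⊆ c) → ∀ n, ∃ m ≥ n, m ∈ c := by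
    intro c hc n
    obtain ⟨k, hk, hkc⟩ := hc (n + 1)
    obtain ⟨i, hi⟩ := J₀.2.nonempty k
    obtain ⟨l, hl⟩ : ∃ l, n ∈ J₀.1 l := mem_iUnion.1 (J₀.2.cover ▸ mem_univ n)
    obtain ⟨k', hk', hkc'⟩ := hc (l + 1)
    obtain ⟨m, hm⟩ := J₀.2.nonempty k'
    exact ⟨m, (J₀.2.lt_of_lt hk' hl hm).le, hkc' hm⟩
  have u1 := hAx _ (hJ₀ a.1 (escape _ h2) h1)
  have u2 := hAx _ (hJ₀ (a.1)ᶜ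
    (fun n => (escape _ h1 n).imp fun m hm => ⟨hm.1, not_not.2 hm.2⟩) h2)
  filter_upwards [hJ, forced_iff_eventually.1 u1, forced_iff_eventually.1 u2]
    with G ⟨J, hτJ, hσJ⟩ hG1 hG2
  rw [hσJ] at hG1 hG2
  rw [hτJ]
  refine (RealRel.sat_neg_fml _ a J).2 ((not_finSplit_rel_iff a J).2 ⟨?_, ?_⟩)
  · exact J.2.exists_block_subset ((RealRel.sat_neg_fml _ _ _).1 hG1)
  · exact J.2.exists_block_subset ((RealRel.sat_neg_fml _ _ _).1 hG2)

/-! ## Posets covered by countably many bounding pieces -/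

/-- A set `Q` of conditions is bounding if for every increasing sequence of open sets with dense
union, some member of the sequence is met below every element of `Q`. -/
def Bounding {P : Type u} [Preorder P] (Q : Set P) : Prop :=
  ∀ B : ℕ → Set P, Monotone B → (∀ m, IsLowerSet (B m)) → (∀ p, ∃ q ≤ p, ∃ m, q ∈ B m) →
    ∃ m, ∀ p ∈ Q, ∃ q ≤ p, q ∈ B m

/-- No condition in `Q i` can force the value at `k` of the named function above `h i k`; the
functions `h i` form the countable set. -/
theorem Plus.ltStar_of_bounding {P : Type u} [Preorder P] {ι : Type*} [Countable ι]
    {Q : ι → Set P} (hQ : ∀ i, Bounding (Q i)) (hcov : ∀ p, ∃ i, p ∈ Q i) : Plus P ltStar := by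
  intro τ hτ
  have hcode := forced_iff_eventually.1 hτ
  have hB : ∀ i k, ∃ m, ∀ p ∈ Q i, ∃ q ≤ p, ∃ j ≤ m, Forces τ q (.mem k j) := by
    intro i k
    refine hQ i (fun m => {q | ∃ j ≤ m, Forces τ q (.mem k j)})
      (fun m m' hmm q ⟨j, hj, hf⟩ => ⟨j, hj.trans hmm, hf⟩)
      (fun m p q hqp ⟨j, hj, hf⟩ => ⟨j, hj, hf.mono hqp⟩) fun p => ?_
    obtain ⟨G, hpG, hG, hsat⟩ := exists_mem_of_eventually_generic (hcode.and
      (eventually_countable_forall.2 fun j => eventually_sat_iff τ (.mem k j))) p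
    obtain ⟨y, hy⟩ := (ltStar.sat_isCode _).1 hG
    have hm : Fml.Sat (eval τ G) (.mem k (y k)) := by
      rw [← hy]; rfl
    obtain ⟨q, hqG, hf⟩ := (hsat (y k)).1 hm
    obtain ⟨r, -, hrp, hrq⟩ := exists_le_le_of_mem hpG hqG
    exact ⟨r, hrp, y k, y k, le_rfl, hf.mono hrq⟩
  choose h hh using hB
  refine ⟨range h, countable_range h, fun x hx p q _ hf => ?_⟩
  obtain ⟨G, hqG, hcG, h1, h2⟩ := exists_mem_of_eventually_generic (hcode.and
    ((eventually_sat_iff τ (ltStar.fml x)).and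
      (eventually_countable_forall.2 fun n => eventually_sat_iff τ (ltStar.relFml n x)))) q
  obtain ⟨n, hn⟩ := (Fml.sat_ex _ _).1 (h1.2 ⟨q, hqG, hf⟩)
  -- Fixing `n` by one condition `p'` places the whole argument in a single piece `Q i`.
  obtain ⟨p', -, hp'⟩ := (h2 n).1 hn
  obtain ⟨i, hi⟩ := hcov p'
  obtain ⟨k, hk, hxk⟩ : ∃ k ≥ n, h i k ≤ x k := by
    by_contra! hlt
    exact hx _ (mem_range_self i) ⟨n, hlt⟩
  obtain ⟨r, hr, j, hj, hfj⟩ := hh i k p' hi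
  obtain ⟨G', hrG, hcG', h3, h4⟩ := exists_mem_of_eventually_generic (hcode.and
    ((eventually_sat_iff τ (ltStar.relFml n x)).and (eventually_sat_iff τ (.mem k j)))) r
  obtain ⟨y, hy⟩ := (ltStar.sat_isCode _).1 hcG'
  have hlt := h3.2 ⟨r, hrG, hp'.mono hr⟩
  have hmem := h4.2 ⟨r, hrG, hfj⟩
  rw [← hy] at hlt hmem
  have hjy : j = y k := hmem
  have hxy : x k < y k := (ltStar.sat_relFml n x y).1 hlt k hk
  omega

/-! ## Random forcing -/

instance : IsProbabilityMeasure cantorMeasure := by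
  unfold cantorMeasure; infer_instance

theorem PosBorel.le_iff {A B : PosBorel} : A ≤ B ↔ cantorMeasure (A.1 \ B.1) = 0 := Iff.rfl

/-- If `p m` were counterexamples, their limsup would have measure at least `ε`. A condition below
it in some `B i` meets some `p m` with `m ≥ i` in positive measure, and this intersection lies in `B
m`. -/
theorem PosBorel.bounding {ε : ENNReal} (hε : ε ≠ 0) :
    Bounding {A : PosBorel | ε ≤ cantorMeasure A.1} := by
  intro B hmono hlow hdense
  by_contra! hcon
  choose p hpε hp using hcon
  let U : ℕ → Set (ℕ → Bool) := fun n => ⋃ m ≥ n, (p m).1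
  have hUm : ∀ n, MeasurableSet (U n) := fun n =>
    .iUnion fun m => .iUnion fun _ => (p m).2.1
  have hUanti : Antitone U := fun n n' hnn =>
    biUnion_subset_biUnion_left fun m (hm : n' ≤ m) => hnn.trans hm
  have hμ : ε ≤ cantorMeasure (⋂ n, U n) := by
    rw [hUanti.measure_iInter (fun n => (hUm n).nullMeasurableSet) ⟨0, measure_ne_top _ _⟩]
    exact le_iInf fun n => (hpε n).trans <|
      measure_mono (subset_biUnion_of_mem (u := fun m => (p m).1) (le_refl n))
  obtain ⟨q, hq, i, hqi⟩ := hdense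
    ⟨⋂ n, U n, .iInter hUm, fun h0 => hε (le_zero_iff.1 (hμ.trans h0.le))⟩
  obtain ⟨m, hm, hpos⟩ : ∃ m ≥ i, cantorMeasure (q.1 ∩ (p m).1) ≠ 0 := by
    by_contra! h0
    refine q.2.2 (measure_mono_null ?_ (measure_union_null (PosBorel.le_iff.1 hq)
      (measure_iUnion_null fun m => measure_iUnion_null fun hm : m ≥ i => h0 m hm)))
    intro x hx
    by_cases hxU : x ∈ ⋂ n, U n
    · obtain ⟨m, hm, hxm⟩ := mem_iUnion₂.1 (mem_iInter.1 hxU i)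
      exact .inr (mem_iUnion₂.2 ⟨m, hm, hx, hxm⟩)
    · exact .inl ⟨hx, hxU⟩
  let r : PosBorel := ⟨q.1 ∩ (p m).1, q.2.1.inter (p m).2.1, hpos⟩
  have hrp : r ≤ p m := PosBorel.le_iff.2 (by
    rw [sdiff_eq_empty.2 (inter_subset_right : r.1 ⊆ (p m).1), measure_empty])
  have hrq : r ≤ q := PosBorel.le_iff.2 (by
    rw [sdiff_eq_empty.2 (inter_subset_left : r.1 ⊆ q.1), measure_empty])
  exact hp m r hrp (hmono hm (hlow i hrq hqi))

theorem Bounding.image_toAntisymmetrization {P : Type u} [Preorder P] {Q : Set P}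
    (hQ : Bounding Q) : Bounding ((toAntisymmetrization (· ≤ ·) : P → Antisymmetrization P (· ≤ ·)) '' Q) := by
  intro B hmono hlow hdense
  obtain ⟨m, hm⟩ := hQ (fun m => toAntisymmetrization (· ≤ ·) ⁻¹' B m)
    (fun m m' hmm => preimage_mono (hmono hmm))
    (fun m p q hqp hp => hlow m (toAntisymmetrization_mono hqp) hp) fun p => by
      obtain ⟨q, hq, m, hqm⟩ := hdense (toAntisymmetrization (· ≤ ·) p)
      induction q using Antisymmetrization.ind with
      | _ q => exact ⟨q, toAntisymmetrization_le_toAntisymmetrization_iff.1 hq, m, hqm⟩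
  refine ⟨m, ?_⟩
  rintro _ ⟨p, hp, rfl⟩
  obtain ⟨q, hq, hqm⟩ := hm p hp
  exact ⟨_, toAntisymmetrization_mono hq, hqm⟩

theorem plus_randomForcing_ltStar : Plus RandomForcing ltStar := by
  refine Plus.ltStar_of_bounding (Q := fun n : ℕ => toAntisymmetrization (· ≤ ·) ''
    {A : PosBorel | (n : ENNReal)⁻¹ ≤ cantorMeasure A.1})
    (fun n => (PosBorel.bounding (ENNReal.inv_ne_zero.2 (ENNReal.natCast_ne_top n))).image_toAntisymmetrization) fun p => ?_
  induction p using Antisymmetrization.ind with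
  | _ A =>
    obtain ⟨n, hn⟩ := ENNReal.exists_inv_nat_lt A.2.2
    exact ⟨n, A, hn.le, rfl⟩

/-! ## Eventually different forcing -/

/-- Along an ultrafilter, a sequence of functions is eventually different at each point from any
value omitted by a suitable limit function. -/
theorem exists_ultralimit {α : Type*} (𝒰 : Ultrafilter α) (f : α → ℕ → ℕ) :
    ∃ g : ℕ → ℕ, ∀ k v, v ≠ g k → ∀ᶠ m in (𝒰 : Filter α), v ≠ f m k := by
  have h : ∀ k, ∃ w, ∀ v, v ≠ w → ∀ᶠ m in (𝒰 : Filter α), v ≠ f m k := by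
    intro k
    by_cases hw : ∃ w, ∀ᶠ m in (𝒰 : Filter α), w = f m k
    · obtain ⟨w, hw⟩ := hw
      exact ⟨w, fun v hv => hw.mono fun m hm hvm => hv (hvm.trans hm.symm)⟩
    -- Without a limit, every value is avoided by almost all `f m k`, so 0 is arbitrary.
    · exact ⟨0, fun v _ => Ultrafilter.eventually_not.2 fun hv => hw ⟨v, hv⟩⟩
  choose g hg using h
  exact ⟨g, hg⟩

/-- The side functions of counterexamples `p m` have pointwise ultralimits `g i`. A condition `q`
below `(s, range g)` has a finite stem, so for almost all `m` its new values also avoid the side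
functions of `p m`; then `q` and `p m` are compatible. -/
theorem EvDiffForcing.bounding (s : List ℕ) (N : ℕ) :
    Bounding {p : EvDiffForcing | p.stem = s ∧ p.side.card = N} := by
  classical
  intro B hmono hlow hdense
  by_contra! hcon
  choose p hps hp using hcon
  let e : ∀ m, Fin N ≃ (p m).side := fun m => ((p m).side.equivFinOfCardEq (hps m).2).symm
  choose g hg using fun i : Fin N =>
    exists_ultralimit (hyperfilter ℕ) fun m k => (e m i : ℕ → ℕ) k
  obtain ⟨q, ⟨hqs, hqF, hqd⟩, j, hqj⟩ := hdense ⟨s, Finset.univ.image g⟩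
  have hev : ∀ᶠ m in (hyperfilter ℕ : Filter ℕ), ∀ k : Fin q.stem.length, s.length ≤ k →
      ∀ i : Fin N, q.stem[k] ≠ (e m i : ℕ → ℕ) k := by
    refine eventually_all.2 fun k => eventually_imp_distrib_left.2 fun hk =>
      eventually_all.2 fun i => hg i k _ ?_
    exact hqd k k.2 hk (g i) (Finset.mem_image_of_mem _ (Finset.mem_univ i))
  -- The ultrafilter is nonprincipal, so `m` can be taken beyond `j`.
  obtain ⟨m, hm, hjm⟩ := (hev.and (Nat.hyperfilter_le_atTop (eventually_ge_atTop j))).exists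
  let r : EvDiffForcing := ⟨q.stem, q.side ∪ (p m).side⟩
  have hrq : r ≤ q := ⟨List.prefix_refl _, Finset.subset_union_left,
    fun i hi hi' => absurd hi (not_lt.2 hi')⟩
  have hrp : r ≤ p m := by
    refine ⟨(hps m).1 ▸ hqs, Finset.subset_union_right, fun i hi hi' f hf => ?_⟩
    have := hm ⟨i, hi⟩ ((hps m).1 ▸ hi') ((e m).symm ⟨f, hf⟩)
    simpa using this
  exact hp m r hrp (hmono hjm (hlow j hrq hqj))

theorem plus_evDiffForcing_ltStar : Plus EvDiffForcing ltStar :=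
  Plus.ltStar_of_bounding (Q := fun i : List ℕ × ℕ => {p | p.stem = i.1 ∧ p.side.card = i.2})
    (fun i => EvDiffForcing.bounding i.1 i.2) fun p => ⟨(p.stem, p.side.card), rfl, rfl⟩

end PresForcing

theorem lemma2p20 :
    (∀ (P : Type u) [Preorder P],
      PresForcing.Plus P PresForcing.ltStar → PresForcing.Plus P PresForcing.finSplit) ∧
    PresForcing.Plus PresForcing.RandomForcing PresForcing.finSplit ∧
    PresForcing.Plus PresForcing.EvDiffForcing PresForcing.finSplit :=
  ⟨fun _ _ h => h.finSplit_of_ltStar,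
    PresForcing.plus_randomForcing_ltStar.finSplit_of_ltStar,
    PresForcing.plus_evDiffForcing_ltStar.finSplit_of_ltStar⟩
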